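/- Let $\mathbb N=\{0,1,2,\dots\}$. A numerical semigroup is a submonoid $S$ of $(\mathbb N,+)$ with finite complement. For such $S$, let $e(S)$ (the embedding dimension) be the number of non-zero elements of $S$ that are not a sum of two positive elements of $S$; let $t(S)$ (the type) be the number of maximal elements of $\mathbb Z\setminus S$ for the order $x\leqslant_S y\Leftrightarrow y-x\in S$; let $g(S)=\#(\mathbb N\setminus S)$ be the genus and let $c(S)=f(S)+1$ be the conductor, where $f(S)$ is the greatest element of $\mathbb N\setminus S$ (and $f(\mathbb N)=-1$). For positive integers $a,b,d$ put $\langle a,b\rangle=\{ax+by : x,y\in\mathbb N\}$ and $\frac{\langle a,b\rangle}{d}=\{x\in\mathbb N : dx\in\langle a,b\rangle\}$. **Theorem 11.** (i) Let $a,b,d$ be pairwise coprime positive integers with $d\notin\langle a,b\rangle$, and let $S=\frac{\langle a,b\rangle}{d}$. Then $S$ is a numerical semigroup, $$t(S)<e(S),$$ and $S$ has Wilf's property $$\frac{g(S)}{c(S)}\leqslant 1-\frac1{e(S)}.$$ (ii) Consequently, the same holds for every proportionally modular numerical semigroup other than $\mathbb N$: if $a,b,c$ are positive integers and $S=\{x\in\mathbb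 N : (ax \bmod b)\leqslant cx\}\neq\mathbb N$, then $S$ is a numerical semigroup, $t(S)<e(S)$ and $\frac{g(S)}{c(S)}\leqslant 1-\frac1{e(S)}$. -/

import Mathlib

namespace NumSgp

/-- A numerical semigroup is a submonoid of `(ℕ, +)` with finite complement. -/
def IsNumerical (S : AddSubmonoid ℕ) : Prop := ((S : Set ℕ)ᶜ).Finite

/-- The semigroup `⟨a, b⟩` of all non-negative integer combinations of `a` and `b`. -/
def gen (a b : ℕ) : AddSubmonoid ℕ := AddSubmonoid.closure {a, b}

/-- The quotient `S / d = {x ∈ ℕ : d x ∈ S}`. -/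
def quot (S : AddSubmonoid ℕ) (d : ℕ) : AddSubmonoid ℕ where
  carrier := {x | d * x ∈ S}
  zero_mem' := by simp
  add_mem' := by
    intro x y hx hy
    have h := S.add_mem hx hy
    rwa [← mul_add] at h

/-- The semigroup `{x ∈ ℕ : a x mod b ≤ c x}`. -/
def propModular (a b c : ℕ) : AddSubmonoid ℕ where
  carrier := {x | (a * x) % b ≤ c * x}
  zero_mem' := by simp
  add_mem' := by
    intro x y hx hy
    simp only [Set.mem_ofPred_eq] at hx hy ⊢
    rw [mul_add, mul_add, Nat.add_mod]
    exact (Nat.mod_le _ _).trans (Nat.add_le_add hx hy)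

/-- `S` is proportionally modular: `S = {x ∈ ℕ : a x mod b ≤ c x}` with `a, b, c` positive. -/
def IsProportionallyModular (S : AddSubmonoid ℕ) : Prop :=
  ∃ a b c : ℕ, 0 < a ∧ 0 < b ∧ 0 < c ∧ S = propModular a b c

/-- The irreducible elements: the non-zero elements of `S` that are not a sum of two positive
elements of `S`. This is the minimal set of generators of `S`. -/
def irr (S : AddSubmonoid ℕ) : Set ℕ :=
  {s | s ∈ S ∧ s ≠ 0 ∧ ¬ ∃ x ∈ S, ∃ y ∈ S, 0 < x ∧ 0 < y ∧ s = x + y}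

/-- The embedding dimension `e(S)`. -/
noncomputable def embDim (S : AddSubmonoid ℕ) : ℕ := (irr S).ncard

/-- The set of gaps `ℕ \ S`. -/
def gaps (S : AddSubmonoid ℕ) : Set ℕ := (S : Set ℕ)ᶜ

/-- The genus `g(S)`. -/
noncomputable def genus (S : AddSubmonoid ℕ) : ℕ := (gaps S).ncard

open Classical in
/-- The Frobenius number `f(S)`: the greatest gap, and `-1` if there is no gap. -/
noncomputable def frobenius (S : AddSubmonoid ℕ) : ℤ :=
  if gaps S = ∅ then -1 else ((sSup (gaps S) : ℕ) : ℤ)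

/-- The conductor `c(S) = f(S) + 1`. -/
noncomputable def conductor (S : AddSubmonoid ℕ) : ℤ := frobenius S + 1

/-- `S` as a subset of `ℤ`. -/
def intSet (S : AddSubmonoid ℕ) : Set ℤ := (fun n : ℕ => (n : ℤ)) '' (S : Set ℕ)

/-- The order on `ℤ` induced by `S`: `x ≤_S y` iff `y - x ∈ S`. -/
def leS (S : AddSubmonoid ℕ) (x y : ℤ) : Prop := y - x ∈ intSet S

/-- The pseudo-Frobenius numbers: the maximal elements of `ℤ \ S` for `≤_S`. -/
def pseudoFrobenius (S : AddSubmonoid ℕ) : Set ℤ :=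
  {p | p ∉ intSet S ∧ ∀ q : ℤ, q ∉ intSet S → leS S p q → q = p}

/-- The type `t(S)`. -/
noncomputable def type (S : AddSubmonoid ℕ) : ℕ := (pseudoFrobenius S).ncard

/-- Wilf's property `g(S) / c(S) ≤ 1 - 1 / e(S)`. -/
def Wilf (S : AddSubmonoid ℕ) : Prop :=
  (genus S : ℚ) / (conductor S : ℚ) ≤ 1 - 1 / (embDim S : ℚ)

/-- All large integers lie in a numerical semigroup. -/
theorem IsNumerical.exists_bound {S : AddSubmonoid ℕ} (h : IsNumerical S) :
    ∃ N : ℕ, 0 < N ∧ ∀ n, N ≤ n → n ∈ S := by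
  obtain ⟨M, hM⟩ := h.bddAbove
  refine ⟨M + 1, Nat.succ_pos _, fun n hn => ?_⟩
  by_contra hc
  have : n ≤ M := hM hc
  omega

/-- The cardinality defining `embDim` is that of a finite set. -/
theorem IsNumerical.irr_finite {S : AddSubmonoid ℕ} (h : IsNumerical S) : (irr S).Finite := by
  obtain ⟨N, hN, hS⟩ := h.exists_bound
  refine (Set.finite_Iic (2 * N)).subset fun s hs => ?_
  by_contra hc
  have hc' : 2 * N < s := by simpa using hc
  exact hs.2.2 ⟨N, hS N le_rfl, s - N, hS _ (by omega), hN, by omega, by omega⟩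

/-- The cardinality defining `type` is that of a finite set. -/
theorem IsNumerical.pseudoFrobenius_finite {S : AddSubmonoid ℕ} (h : IsNumerical S) :
    (pseudoFrobenius S).Finite := by
  obtain ⟨N, hN, hS⟩ := h.exists_bound
  refine (Set.finite_Icc (-(N : ℤ) - 1) N).subset fun p hp => ?_
  have key : ∀ z : ℤ, (N : ℤ) ≤ z → z ∈ intSet S := fun z hz =>
    ⟨z.toNat, hS _ (by omega), by simp only; omega⟩
  have hneg : (-1 : ℤ) ∉ intSet S := by
    rintro ⟨n, -, hn⟩
    simp only at hn
    omega
  constructor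
  · by_contra hc
    have := hp.2 (-1) hneg (key _ (by omega))
    omega
  · by_contra hc
    exact hp.1 (key _ (by omega))

end NumSgp

/-! Both families are projections of the lattice points of a plane cone. If x is not in S, two
adjacent lattice points (x, k), (x, k + 1) lie strictly under the line of u and strictly over that
of w, at depths p = -cross u (x, k) and q = -cross (x, k + 1) w. If x is pseudo-Frobenius, every
non-zero cone point v has cross u v ≥ p or cross v w ≥ q. The irreducible cone points form a
staircase in the coordinates (cross u v, cross v w); send x to the last step with first coordinate
below p. This is injective (`eq_of_separating`) and misses the top step, so the type is less than
the number of steps. Once the cone is narrowed (`exists_narrow`), the steps inject into the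
generators of S, whence t < e. Wilf's inequality follows from g ≤ t (c - g). -/

namespace NumSgp

/-! ### Lattice cones in the plane -/

/-- The determinant of two lattice vectors. -/
def cross (u v : ℤ × ℤ) : ℤ := u.1 * v.2 - u.2 * v.1

/-- The lattice points between the rays spanned by `u` (below) and `w` (above). -/
def cone (u w : ℤ × ℤ) : Set (ℤ × ℤ) := {v | 0 ≤ cross u v ∧ 0 ≤ cross v w}

/-- The non-zero lattice points of the cone that are not a sum of two non-zero ones. -/
def coneIrr (u w : ℤ × ℤ) : Set (ℤ × ℤ) :=
  {h | h ∈ cone u w ∧ h ≠ 0 ∧ ∀ x ∈ cone u w, h - x ∈ cone u w → x = 0 ∨ x = h}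

/-- `S` is the projection to the first coordinate of the lattice points of a cone contained in
the right half plane. -/
structure IsConeProj (S : AddSubmonoid ℕ) (u w : ℤ × ℤ) : Prop where
  fst_pos_left : 0 < u.1
  fst_pos_right : 0 < w.1
  cross_pos : 0 < cross u w
  mem_iff : ∀ n : ℕ, n ∈ S ↔ ∃ k : ℤ, ((n : ℤ), k) ∈ cone u w

theorem cross_add_right (u v v' : ℤ × ℤ) : cross u (v + v') = cross u v + cross u v' := by
  simp only [cross, Prod.fst_add, Prod.snd_add]; ring

theorem cross_add_left (v v' w : ℤ × ℤ) : cross (v + v') w = cross v w + cross v' w := by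
  simp only [cross, Prod.fst_add, Prod.snd_add]; ring

theorem cross_sub_right (u v v' : ℤ × ℤ) : cross u (v - v') = cross u v - cross u v' := by
  simp only [cross, Prod.fst_sub, Prod.snd_sub]; ring

theorem cross_sub_left (v v' w : ℤ × ℤ) : cross (v - v') w = cross v w - cross v' w := by
  simp only [cross, Prod.fst_sub, Prod.snd_sub]; ring

theorem cross_self (u : ℤ × ℤ) : cross u u = 0 := by
  simp only [cross]; ring

/-- Cramer's rule: up to the factor `cross u w`, the two determinants are the coordinates of v in
the basis u, w. -/
theorem cross_mul_fst (u v w : ℤ × ℤ) :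
    cross u w * v.1 = cross v w * u.1 + cross u v * w.1 := by
  simp only [cross]; ring

theorem cross_mul_snd (u v w : ℤ × ℤ) :
    cross u w * v.2 = cross v w * u.2 + cross u v * w.2 := by
  simp only [cross]; ring

theorem cone_add {u w v v' : ℤ × ℤ} (hv : v ∈ cone u w) (hv' : v' ∈ cone u w) :
    v + v' ∈ cone u w :=
  ⟨by rw [cross_add_right]; exact add_nonneg hv.1 hv'.1,
    by rw [cross_add_left]; exact add_nonneg hv.2 hv'.2⟩

theorem eq_zero_of_cross_eq_zero {u v w : ℤ × ℤ} (hN : 0 < cross u w) (h₁ : cross u v = 0)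
    (h₂ : cross v w = 0) : v = 0 := by
  have e₁ := cross_mul_fst u v w
  have e₂ := cross_mul_snd u v w
  rw [h₁, h₂, zero_mul, zero_mul, add_zero] at e₁ e₂
  ext
  · simpa [hN.ne'] using e₁
  · simpa [hN.ne'] using e₂

/-- Every non-zero lattice point of a cone is an irreducible one plus a lattice point. -/
theorem exists_coneIrr_sub_mem {u w : ℤ × ℤ} (hN : 0 < cross u w) {v : ℤ × ℤ}
    (hv : v ∈ cone u w) (hv0 : v ≠ 0) : ∃ h ∈ coneIrr u w, v - h ∈ cone u w := by
  induction hn : (cross u v + cross v w).toNat using Nat.strong_induction_on generalizing v with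
  | _ n ih =>
  by_cases hirr : v ∈ coneIrr u w
  · exact ⟨v, hirr, by simp [cone, cross]⟩
  obtain ⟨x, hx, hxv, hx0, hxne⟩ :
      ∃ x ∈ cone u w, v - x ∈ cone u w ∧ x ≠ 0 ∧ x ≠ v := by
    by_contra! hc
    exact hirr ⟨hv, hv0, fun x hx hxv => or_iff_not_imp_left.2 (hc x hx hxv)⟩
  have hlt : (cross u x + cross x w).toNat < n := by
    have hpos : 0 < cross u (v - x) + cross (v - x) w := by
      refine lt_of_le_of_ne (add_nonneg hxv.1 hxv.2) fun h0 => hxne ?_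
      have := hxv.1
      have := hxv.2
      exact (sub_eq_zero.1 (eq_zero_of_cross_eq_zero hN (by omega) (by omega))).symm
    rw [cross_sub_right, cross_sub_left] at hpos
    have := hx.1
    have := hx.2
    omega
  obtain ⟨h, hh, hxh⟩ := ih _ hlt hx hx0 rfl
  exact ⟨h, hh, by simpa using cone_add hxv hxh⟩

/-- The irreducible lattice points of a cone form an antichain. -/
theorem coneIrr_antichain {u w h h' : ℤ × ℤ} (hh : h ∈ coneIrr u w) (hh' : h' ∈ coneIrr u w)
    (h₁ : cross u h ≤ cross u h') (h₂ : cross h w ≤ cross h' w) : h = h' := by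
  refine (hh'.2.2 h hh.1 ⟨?_, ?_⟩).resolve_left hh.2.1
  · rw [cross_sub_right]; omega
  · rw [cross_sub_left]; omega

/-! ### Type and embedding dimension of a projected cone -/

namespace IsConeProj

variable {S : AddSubmonoid ℕ} {u w : ℤ × ℤ}

theorem fst_nonneg (h : IsConeProj S u w) {v : ℤ × ℤ} (hv : v ∈ cone u w) : 0 ≤ v.1 := by
  have e := cross_mul_fst u v w
  have := mul_nonneg hv.2 h.fst_pos_left.le
  have := mul_nonneg hv.1 h.fst_pos_right.le
  exact nonneg_of_mul_nonneg_right (by omega) h.cross_pos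

theorem fst_pos (h : IsConeProj S u w) {v : ℤ × ℤ} (hv : v ∈ cone u w) (hv0 : v ≠ 0) :
    0 < v.1 := by
  refine lt_of_le_of_ne (h.fst_nonneg hv) fun h0 => hv0 ?_
  have e := cross_mul_fst u v w
  have h₁ := mul_nonneg hv.2 h.fst_pos_left.le
  have h₂ := mul_nonneg hv.1 h.fst_pos_right.le
  rw [← h0, mul_zero] at e
  refine eq_zero_of_cross_eq_zero h.cross_pos ?_ ?_
  · have : cross u v * w.1 = 0 := by omega
    simpa [h.fst_pos_right.ne'] using this
  · have : cross v w * u.1 = 0 := by omega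
    simpa [h.fst_pos_left.ne'] using this

theorem mem_intSet_iff (h : IsConeProj S u w) (x : ℤ) :
    x ∈ intSet S ↔ ∃ k : ℤ, (x, k) ∈ cone u w := by
  constructor
  · rintro ⟨n, hn, rfl⟩
    exact (h.mem_iff n).1 hn
  · rintro ⟨k, hk⟩
    obtain ⟨n, rfl⟩ := Int.eq_ofNat_of_zero_le (h.fst_nonneg hk)
    exact ⟨n, (h.mem_iff n).2 ⟨k, hk⟩, rfl⟩

/-- The cone's segment over n has length n * cross u w / (u.1 * w.1), at least 1 for n ≥ u.1 * w.1.
-/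
theorem isNumerical (h : IsConeProj S u w) : IsNumerical S := by
  refine (Set.finite_Iio (u.1 * w.1).toNat).subset fun n hn => ?_
  by_contra hc
  refine hn ((h.mem_iff n).2 ⟨-((-(u.2 * n)) / u.1), ?_, ?_⟩)
  · have := Int.mul_ediv_self_le (x := -(u.2 * n)) h.fst_pos_left.ne'
    simp only [cross]
    linarith
  · have h₁ := Int.lt_mul_ediv_self_add (x := -(u.2 * n)) h.fst_pos_left
    have h₂ : u.1 * w.1 ≤ n := by
      have : ¬ n < (u.1 * w.1).toNat := hc
      omega
    have h₃ := h.cross_pos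
    have h₄ := h.fst_pos_left
    have h₅ := h.fst_pos_right
    simp only [cross] at h₃ ⊢
    set k := -(u.2 * (n : ℤ)) / u.1
    refine nonneg_of_mul_nonneg_right (a := u.1) ?_ h₄
    nlinarith [mul_pos h₄ h₅]

/-- Below a non-member `x` there is a lattice point under the cone whose upper neighbour is over
the cone. -/
theorem exists_below (h : IsConeProj S u w) {x : ℤ} (hx : x ∉ intSet S) :
    ∃ k : ℤ, cross u (x, k) < 0 ∧ cross (x, k + 1) w < 0 := by
  have h₁ := Int.mul_ediv_self_le (x := -(u.2 * x)) h.fst_pos_left.ne'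
  have h₂ := Int.lt_mul_ediv_self_add (x := -(u.2 * x)) h.fst_pos_left
  set k := -(u.2 * x) / u.1
  refine ⟨-k - 1, ?_, ?_⟩
  · simp only [cross]; linarith
  · by_contra! hc
    refine hx ((h.mem_intSet_iff x).2 ⟨-k - 1 + 1, ?_, hc⟩)
    simp only [cross]; linarith

theorem add_mem_of_mem_pseudoFrobenius {x : ℤ} (hx : x ∈ pseudoFrobenius S) {s : ℤ}
    (hs : s ∈ intSet S) (hs0 : s ≠ 0) : x + s ∈ intSet S := by
  by_contra hc
  have := hx.2 (x + s) hc (by simpa [leS] using hs)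
  omega

/-- A non-zero lattice point of the cone moves at least one of the two lattice points adjacent to
the cone over a pseudo-Frobenius number into the cone. -/
theorem le_cross_or_le_cross (h : IsConeProj S u w) {x k : ℤ} (hx : x ∈ pseudoFrobenius S)
    {v : ℤ × ℤ} (hv : v ∈ cone u w) (hv0 : v ≠ 0) :
    -cross u (x, k) ≤ cross u v ∨ -cross (x, k + 1) w ≤ cross v w := by
  obtain ⟨j, hj⟩ := (h.mem_intSet_iff _).1 (add_mem_of_mem_pseudoFrobenius hx
    ((h.mem_intSet_iff v.1).2 ⟨v.2, hv⟩) (h.fst_pos hv hv0).ne')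
  obtain ⟨h₁, h₂⟩ := hj
  have hu := h.fst_pos_left
  have hw := h.fst_pos_right
  simp only [cross] at h₁ h₂ ⊢
  -- The cone point over x + v.1 is either at or below (x, k) + v, or at or above (x, k + 1) + v.
  rcases le_or_gt j (v.2 + k) with hjk | hjk
  · left; nlinarith
  · right; nlinarith [Int.add_one_le_iff.2 hjk]

/-- If the same irreducible point `v` lies closest under the depths of the points adjacent to the
cone over two pseudo-Frobenius numbers, then these numbers agree. -/
theorem eq_of_separating (h : IsConeProj S u w) {x k x' k' : ℤ} (hx : x ∈ pseudoFrobenius S)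
    (hx' : x' ∈ pseudoFrobenius S) (hq : cross (x, k + 1) w < 0) {v : ℤ × ℤ}
    (hv : v ∈ coneIrr u w) (hvp' : cross u v < -cross u (x', k'))
    (hmax : ∀ t ∈ coneIrr u w, cross u t < -cross u (x, k) → cross u t ≤ cross u v)
    (hpp : cross u (x, k) ≤ cross u (x', k')) : x = x' := by
  have hq' : -cross (x', k' + 1) w ≤ cross v w :=
    (h.le_cross_or_le_cross (k := k') hx' hv.1 hv.2.1).resolve_left (by omega)
  have hD₁ : cross u ((x', k') - (x, k)) = cross u (x', k') - cross u (x, k) := cross_sub_right ..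
  have hD₂ : cross ((x', k') - (x, k)) w = cross (x', k' + 1) w - cross (x, k + 1) w := by
    simp only [cross, Prod.mk_sub_mk]; ring
  set D := (x', k') - (x, k) with hD
  by_cases hqq : cross (x, k + 1) w ≤ cross (x', k' + 1) w
  · have hmem : x' - x ∈ intSet S :=
      (h.mem_intSet_iff _).2 ⟨k' - k, by change D ∈ _; exact ⟨by omega, by omega⟩⟩
    exact (hx.2 x' hx'.1 hmem).symm
  -- Now D + v lies in the cone. An irreducible t under it has first coordinate below the depth of
  -- (x, k), hence at most that of v, and a strictly smaller second one: the antichain property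
  -- fails.
  exfalso
  have e₁ := cross_add_right u D v
  have e₂ := cross_add_left D v w
  have hv₁ := hv.1.1
  have hne : D + v ≠ 0 := by
    intro h0
    have : cross (D + v) w = 0 := by rw [h0]; simp [cross]
    omega
  obtain ⟨t, ht, h₁, h₂⟩ :=
    exists_coneIrr_sub_mem h.cross_pos (v := D + v) ⟨by omega, by omega⟩ hne
  rw [cross_sub_right] at h₁
  rw [cross_sub_left] at h₂
  obtain rfl := coneIrr_antichain ht hv (hmax t ht (by omega)) (by omega)
  omega

theorem type_lt_ncard_coneIrr (h : IsConeProj S u w) (hfin : (coneIrr u w).Finite) :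
    type S < (coneIrr u w).ncard := by
  have hu := h.fst_pos_left
  have hw := h.fst_pos_right
  -- `bot` and `top` lie on the rays of u and w: the first makes the choice of a step possible, the
  -- second is never chosen.
  obtain ⟨bot, hbot, hbot₁, -⟩ := exists_coneIrr_sub_mem h.cross_pos (v := u)
    ⟨(cross_self u).ge, h.cross_pos.le⟩ (by rintro rfl; simp at hu)
  obtain ⟨top, htop, -, htop₂⟩ := exists_coneIrr_sub_mem h.cross_pos (v := w)
    ⟨h.cross_pos.le, (cross_self w).ge⟩ (by rintro rfl; simp at hw)
  rw [cross_sub_right, cross_self] at hbot₁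
  rw [cross_sub_left, cross_self] at htop₂
  have key : ∀ x ∈ pseudoFrobenius S, ∃ v : ℤ × ℤ, ∃ k : ℤ, cross (x, k + 1) w < 0 ∧
      v ∈ coneIrr u w ∧ cross u v < -cross u (x, k) ∧
      ∀ t ∈ coneIrr u w, cross u t < -cross u (x, k) → cross u t ≤ cross u v := by
    intro x hx
    obtain ⟨k, hk₁, hk₂⟩ := h.exists_below hx.1
    obtain ⟨v, ⟨hv, hvk⟩, hmax⟩ := Set.exists_max_image
      {t ∈ coneIrr u w | cross u t < -cross u (x, k)} (cross u) (hfin.subset (Set.sep_subset _ _))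
      ⟨bot, hbot, by omega⟩
    exact ⟨v, k, hk₂, hv, hvk, fun t ht htk => hmax t ⟨ht, htk⟩⟩
  choose! f k hk hf hfk hmax using key
  have hmaps : ∀ x ∈ pseudoFrobenius S, f x ∈ coneIrr u w \ {top} := by
    refine fun x hx => ⟨hf x hx, fun heq => ?_⟩
    have := (h.le_cross_or_le_cross (k := k x) hx (hf x hx).1 (hf x hx).2.1).resolve_left
      (not_le.2 (hfk x hx))
    have hkx := hk x hx
    rw [Set.mem_singleton_iff.1 heq] at this
    omega
  have hinj : Set.InjOn f (pseudoFrobenius S) := by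
    intro x hx x' hx' heq
    rcases le_total (cross u (x, k x)) (cross u (x', k x')) with hle | hle
    · exact h.eq_of_separating hx hx' (hk x hx) (hf x hx) (heq ▸ hfk x' hx') (hmax x hx) hle
    · exact (h.eq_of_separating hx' hx (hk x' hx') (hf x' hx') (heq ▸ hfk x hx) (hmax x' hx')
        hle).symm
  exact (Set.ncard_le_ncard_of_injOn f hmaps hinj (hfin.subset Set.sdiff_subset)).trans_lt
    (Set.ncard_sdiff_singleton_lt_of_mem htop hfin)

/-- In a cone with `cross u w < u.1, w.1` the irreducible lattice points are alone on their
vertical lines. -/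
theorem eq_of_fst_eq_of_mem_coneIrr (h : IsConeProj S u w) (h₁ : cross u w < u.1)
    (h₂ : cross u w < w.1) {v v' : ℤ × ℤ} (hv : v ∈ coneIrr u w) (hv' : v' ∈ cone u w)
    (hfst : v.1 = v'.1) : v = v' := by
  have hu := h.fst_pos_left
  have hw := h.fst_pos_right
  obtain ⟨⟨c₁, c₂⟩, -, hirr⟩ := hv
  obtain ⟨c₁', c₂'⟩ := hv'
  rcases lt_trichotomy v.2 v'.2 with hlt | heq | hlt
  · have hN : w.1 ≤ cross v w := by
      simp only [cross] at c₂' ⊢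
      rw [hfst]; nlinarith [Int.add_one_le_iff.2 hlt]
    -- As cross v w ≥ w.1 > cross u w, the point v - u stays in the cone; irreducibility forces v =
    -- u, against the same bound.
    rcases hirr u ⟨(cross_self u).ge, h.cross_pos.le⟩
      ⟨by rw [cross_sub_right, cross_self]; omega, by rw [cross_sub_left]; omega⟩ with h0 | rfl
    · rw [h0] at hu; simp at hu
    · omega
  · exact Prod.ext hfst heq
  · have hN : u.1 ≤ cross u v := by
      simp only [cross] at c₁' ⊢
      rw [hfst]; nlinarith [Int.add_one_le_iff.2 hlt]
    rcases hirr w ⟨h.cross_pos.le, (cross_self w).ge⟩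
      ⟨by rw [cross_sub_right]; omega, by rw [cross_sub_left, cross_self]; omega⟩ with h0 | rfl
    · rw [h0] at hw; simp at hw
    · omega

/-- Uniqueness on vertical lines lifts any splitting of v.1 in S to a splitting of v in the cone. -/
theorem type_lt_embDim (h : IsConeProj S u w) (h₁ : cross u w < u.1) (h₂ : cross u w < w.1) :
    type S < embDim S := by
  have hmaps : ∀ v ∈ coneIrr u w, v.1.toNat ∈ irr S := by
    intro v hv
    have hpos := h.fst_pos hv.1 hv.2.1
    have hcast : (v.1.toNat : ℤ) = v.1 := Int.toNat_of_nonneg hpos.le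
    refine ⟨(h.mem_iff _).2 ⟨v.2, by rw [hcast]; exact hv.1⟩, by omega, ?_⟩
    rintro ⟨x, hx, y, hy, hx0, hy0, hxy⟩
    obtain ⟨i, hi⟩ := (h.mem_iff x).1 hx
    obtain ⟨j, hj⟩ := (h.mem_iff y).1 hy
    have heq := h.eq_of_fst_eq_of_mem_coneIrr h₁ h₂ hv (cone_add hi hj)
      (by simp only [Prod.fst_add]; omega)
    rcases hv.2.2 _ hi (by rw [heq, add_sub_cancel_left]; exact hj) with h0 | h0
    · have := congrArg Prod.fst h0
      simp at this
      omega
    · have := congrArg Prod.fst h0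
      simp at this
      omega
  have hinj : Set.InjOn (fun v : ℤ × ℤ => v.1.toNat) (coneIrr u w) := by
    intro v hv v' hv' heq
    have := h.fst_pos hv.1 hv.2.1
    have := h.fst_pos hv'.1 hv'.2.1
    exact h.eq_of_fst_eq_of_mem_coneIrr h₁ h₂ hv hv'.1 (by simp only at heq; omega)
  have hirr := h.isNumerical.irr_finite
  have hfin : (coneIrr u w).Finite :=
    Set.Finite.of_finite_image (hirr.subset (Set.image_subset_iff.2 hmaps)) hinj
  exact (h.type_lt_ncard_coneIrr hfin).trans_le (Set.ncard_le_ncard_of_injOn _ hmaps hinj hirr)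

end IsConeProj

/-! ### Shrinking the cone -/

theorem subset_of_irr_subset {S T : AddSubmonoid ℕ} (hT : irr S ⊆ T) : S ≤ T := by
  intro n
  induction n using Nat.strong_induction_on with
  | _ n ih =>
  intro hn
  by_cases hirr : n ∈ irr S
  · exact hT hirr
  rcases eq_or_ne n 0 with rfl | hn0
  · exact T.zero_mem
  obtain ⟨x, hx, y, hy, hx0, hy0, rfl⟩ :
      ∃ x ∈ S, ∃ y ∈ S, 0 < x ∧ 0 < y ∧ n = x + y := by
    by_contra hc
    exact hirr ⟨hn, hn0, hc⟩
  exact T.add_mem (ih x (by omega) hx) (ih y (by omega) hy)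

theorem eq_top_of_one_mem {S : AddSubmonoid ℕ} (h : 1 ∈ S) : S = ⊤ := by
  refine eq_top_iff.2 fun n _ => ?_
  simpa using S.nsmul_mem h n

/-- The projection of the lattice points of a cone. -/
def coneProj (u w : ℤ × ℤ) : AddSubmonoid ℕ where
  carrier := {n | ∃ k : ℤ, ((n : ℤ), k) ∈ cone u w}
  zero_mem' := ⟨0, by simp [cone, cross]⟩
  add_mem' := by
    rintro m n ⟨i, hi⟩ ⟨j, hj⟩
    exact ⟨i + j, by simpa using cone_add hi hj⟩

/-- A projection of a cone other than `ℕ` is the projection of a cone in which the generating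
vectors are alone on their vertical lines. -/
theorem IsConeProj.exists_narrow {S : AddSubmonoid ℕ} {u₀ w₀ : ℤ × ℤ} (h : IsConeProj S u₀ w₀)
    (hS : S ≠ ⊤) :
    ∃ u w : ℤ × ℤ, IsConeProj S u w ∧ cross u w < u.1 ∧ cross u w < w.1 := by
  have hu₀ := h.fst_pos_left
  have hw₀ := h.fst_pos_right
  -- The lowest lattice point over s on or above the ray of u₀. The new rays pass through the lifted
  -- generators of extreme slope.
  have hlift : ∀ s : ℕ, ∃ k : ℤ, 0 ≤ cross u₀ (s, k) ∧ cross u₀ (s, k - 1) < 0 := by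
    intro s
    have h₁ := Int.mul_ediv_self_le (x := -(u₀.2 * s)) hu₀.ne'
    have h₂ := Int.lt_mul_ediv_self_add (x := -(u₀.2 * s)) hu₀
    refine ⟨-(-(u₀.2 * s) / u₀.1), ?_, ?_⟩ <;> simp only [cross] <;> linarith
  choose κ hκ₁ hκ₂ using hlift
  have hκ : ∀ s ∈ S, ((s : ℤ), κ s) ∈ cone u₀ w₀ := by
    intro s hs
    obtain ⟨k, hk₁, hk₂⟩ := (h.mem_iff s).1 hs
    refine ⟨hκ₁ s, ?_⟩
    have := hκ₂ s
    simp only [cross] at *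
    have hle : κ s ≤ k := by
      by_contra! hc
      nlinarith [Int.add_one_le_iff.2 hc]
    nlinarith
  have hfin := h.isNumerical.irr_finite
  have hne : (irr S).Nonempty := by
    by_contra! hc
    obtain ⟨N, hN, hNS⟩ := h.isNumerical.exists_bound
    have : N ∈ (⊥ : AddSubmonoid ℕ) :=
      subset_of_irr_subset (S := S) (by rw [hc]; exact Set.empty_subset _) (hNS N le_rfl)
    rw [AddSubmonoid.mem_bot] at this
    omega
  obtain ⟨a, ha, hmin⟩ := Set.exists_min_image (irr S) (fun s => (κ s : ℚ) / s) hfin hne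
  obtain ⟨b, hb, hmax⟩ := Set.exists_max_image (irr S) (fun s => (κ s : ℚ) / s) hfin hne
  have hpos : ∀ s ∈ irr S, (0 : ℤ) < s := fun s hs => by
    have := hs.2.1
    omega
  have hslope : ∀ s ∈ irr S, ∀ t ∈ irr S, (κ s : ℚ) / s ≤ (κ t : ℚ) / t →
      0 ≤ cross (s, κ s) (t, κ t) := by
    intro s hs t ht hle
    have h₁ : (0 : ℚ) < s := by exact_mod_cast hpos s hs
    have h₂ : (0 : ℚ) < t := by exact_mod_cast hpos t ht
    rw [div_le_div_iff₀ h₁ h₂] at hle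
    have : κ s * t ≤ κ t * s := by exact_mod_cast hle
    simp only [cross]
    linarith
  have ha0 := hpos a ha
  have hb0 := hpos b hb
  have heq : S = coneProj (a, κ a) (b, κ b) := by
    refine le_antisymm (subset_of_irr_subset fun s hs => ⟨κ s, hslope a ha s hs (hmin s hs),
      hslope s hs b hb (hmax s hs)⟩) ?_
    rintro n ⟨k, hk₁, hk₂⟩
    refine (h.mem_iff n).2 ⟨k, ?_, ?_⟩
    · have := (hκ a ha.1).1
      simp only [cross] at *
      refine nonneg_of_mul_nonneg_right (a := (a : ℤ)) ?_ ha0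
      nlinarith [mul_nonneg hu₀.le hk₁, mul_nonneg (Int.natCast_nonneg n) this]
    · have := (hκ b hb.1).2
      simp only [cross] at *
      refine nonneg_of_mul_nonneg_right (a := (b : ℤ)) ?_ hb0
      nlinarith [mul_nonneg hw₀.le hk₂, mul_nonneg (Int.natCast_nonneg n) this]
  have hmem : ∀ n : ℕ, n ∈ S ↔ ∃ k : ℤ, ((n : ℤ), k) ∈ cone (a, κ a) (b, κ b) := fun n => by
    conv_lhs => rw [heq]
    exact Iff.rfl
  -- With equal slopes the cone is a ray, and subtracting its points over N + 1 and N gives one over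
  -- 1.
  have hN : 0 < cross (a, κ a) (b, κ b) := by
    refine lt_of_le_of_ne (hslope a ha b hb (hmin b hb)) fun h0 => hS (eq_top_of_one_mem ?_)
    obtain ⟨N, -, hNS⟩ := h.isNumerical.exists_bound
    obtain ⟨i, hi₁, hi₂⟩ := (hmem N).1 (hNS N le_rfl)
    obtain ⟨j, hj₁, hj₂⟩ := (hmem (N + 1)).1 (hNS (N + 1) (by omega))
    have key : ∀ v : ℤ × ℤ, (b : ℤ) * cross (a, κ a) v + a * cross v (b, κ b) = 0 := by
      intro v
      have := cross_mul_fst (a, κ a) v (b, κ b)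
      rw [← h0] at this
      linarith
    have ki := key (N, i)
    have kj := key ((N + 1 : ℕ), j)
    have zi₁ : cross (a, κ a) (N, i) = 0 := by nlinarith
    have zi₂ : cross (N, i) (b, κ b) = 0 := by nlinarith
    have e : ((1 : ℕ) : ℤ) = ((N + 1 : ℕ) : ℤ) - N := by push_cast; ring
    refine (hmem 1).2 ⟨j - i, ?_⟩
    rw [e, ← Prod.mk_sub_mk]
    exact ⟨by rw [cross_sub_right, zi₁]; simpa using hj₁,
      by rw [cross_sub_left, zi₂]; simpa using hj₂⟩
  -- (b, κ b - 1) is under u₀, hence under the ray of (a, κ a).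
  have hNa : cross (a, κ a) (b, κ b) < a := by
    have h₁ := hκ₂ b
    have h₂ := hκ₁ a
    simp only [cross] at *
    have : u₀.1 * ((κ b - 1) * a - κ a * b) < 0 := by nlinarith
    have := neg_of_mul_neg_right this hu₀.le
    linarith
  refine ⟨(a, κ a), (b, κ b), ⟨ha0, hb0, hN, hmem⟩, hNa, ?_⟩
  by_contra! hc
  have hc : (b : ℤ) ≤ cross (a, κ a) (b, κ b) := hc
  have hba : b < a := by omega
  -- The point (a, κ a + 1) - (b, κ b) lies in the new cone, so the generator a would split as b +
  -- (a - b).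
  refine ha.2.2 ⟨b, hb.1, a - b, (hmem _).2 ⟨κ a + 1 - κ b, ?_⟩, by omega, by omega, by omega⟩
  rw [Nat.cast_sub hba.le]
  simp only [cone, cross] at *
  constructor <;> linarith

/-! ### Wilf's property from the type -/

theorem sub_mem_intSet_trans {S : AddSubmonoid ℕ} {x y z : ℤ} (h₁ : y - x ∈ intSet S)
    (h₂ : z - y ∈ intSet S) : z - x ∈ intSet S := by
  obtain ⟨m, hm, hm'⟩ := h₁
  obtain ⟨n, hn, hn'⟩ := h₂
  exact ⟨m + n, S.add_mem hm hn, by push_cast; simp only at hm' hn'; omega⟩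

/-- Every non-member lies under a pseudo-Frobenius number. -/
theorem IsNumerical.exists_pseudoFrobenius {S : AddSubmonoid ℕ} (h : IsNumerical S) {x : ℤ}
    (hx : x ∉ intSet S) : ∃ f ∈ pseudoFrobenius S, f - x ∈ intSet S := by
  obtain ⟨N, -, hS⟩ := h.exists_bound
  have hfin : {y : ℤ | y ∉ intSet S ∧ y - x ∈ intSet S}.Finite := by
    refine (Set.finite_Icc x N).subset ?_
    rintro y ⟨hy, n, -, hn⟩
    simp only at hn
    refine ⟨by omega, ?_⟩
    by_contra! hc
    exact hy ⟨y.toNat, hS _ (by omega), by simp only; omega⟩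
  obtain ⟨f, ⟨hf, hfx⟩, hmax⟩ := Set.exists_max_image _ id hfin
    ⟨x, hx, 0, S.zero_mem, by simp⟩
  refine ⟨f, ⟨hf, fun q hq hle => ?_⟩, hfx⟩
  have h₁ : q ≤ f := hmax q ⟨hq, sub_mem_intSet_trans hfx hle⟩
  obtain ⟨n, -, hn⟩ := hle
  simp only at hn
  omega

/-- A gap n lies under some pseudo-Frobenius f, and the pair (f, f - n) determines it. As f - n is
one of the c - g members of S below c, this gives g ≤ t (c - g). -/
theorem IsNumerical.wilf_of_type_lt_embDim {S : AddSubmonoid ℕ} (h : IsNumerical S) (hS : S ≠ ⊤)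
    (ht : type S < embDim S) : Wilf S := by
  have hfin : (gaps S).Finite := h
  have hne : (gaps S).Nonempty := by
    by_contra! hc
    exact hS (eq_top_iff.2 fun n _ => by_contra fun hn => (hc ▸ (show n ∈ gaps S from hn) :))
  set F := sSup (gaps S) with hF
  have hle : ∀ n ∈ gaps S, n ≤ F := fun n hn => le_csSup hfin.bddAbove hn
  have hcond : conductor S = F + 1 := by
    rw [conductor, frobenius, if_neg hne.ne_empty]
  set L : Set ℕ := {n | n ∈ S ∧ n ≤ F} with hL
  have hLfin : L.Finite := (Set.finite_Iic F).subset fun n hn => hn.2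
  have hcard : genus S + L.ncard = F + 1 := by
    have hdisj : Disjoint (gaps S) L :=
      Set.disjoint_left.2 fun n (hn : n ∉ S) hn' => hn hn'.1
    rw [genus, ← Set.ncard_union_eq hdisj hfin hLfin]
    have : gaps S ∪ L = Set.Iic F := by
      ext n
      constructor
      · rintro (hn | hn)
        · exact hle n hn
        · exact hn.2
      · intro hn
        by_cases hnS : n ∈ S
        · exact Or.inr ⟨hnS, hn⟩
        · exact Or.inl hnS
    rw [this, Set.ncard_eq_toFinset_card']
    simp
  have hnot : ∀ n ∈ gaps S, (n : ℤ) ∉ intSet S := by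
    rintro n hn ⟨m, hm, hmn⟩
    have : m = n := Int.ofNat_inj.1 hmn
    exact hn (this ▸ hm)
  have hup : ∀ f ∈ pseudoFrobenius S, f ≤ F := by
    intro f hf
    by_contra! hc
    refine hf.1 ⟨f.toNat, ?_, by simp only; omega⟩
    by_contra hn
    have := hle _ hn
    omega
  choose! φ hφ hφ' using fun (n : ℕ) (hn : n ∈ gaps S) => h.exists_pseudoFrobenius (hnot n hn)
  have hmul : genus S ≤ type S * L.ncard := by
    rw [genus, type, ← Set.ncard_prod]
    refine Set.ncard_le_ncard_of_injOn (fun n => (φ n, (φ n - n).toNat)) ?_ ?_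
      (h.pseudoFrobenius_finite.prod hLfin)
    · intro n hn
      have h₁ := hup _ (hφ n hn)
      obtain ⟨m, hm, hmn⟩ := hφ' n hn
      simp only at hmn
      have h₂ : (φ n - n).toNat = m := by omega
      exact ⟨hφ n hn, h₂.symm ▸ hm, by simp only; omega⟩
    · intro n hn n' hn' heq
      obtain ⟨m, -, hm⟩ := hφ' n hn
      obtain ⟨m', -, hm'⟩ := hφ' n' hn'
      simp only [Prod.mk.injEq] at heq hm hm'
      omega
  rw [Wilf, hcond]
  have he : (0 : ℚ) < embDim S := by exact_mod_cast (Nat.zero_le _).trans_lt ht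
  have hc : (0 : ℚ) < ((F + 1 : ℤ) : ℚ) := by exact_mod_cast Nat.succ_pos F
  rw [div_le_iff₀ hc, one_sub_div he.ne', div_mul_eq_mul_div, le_div_iff₀ he]
  have hcard' : (genus S : ℚ) + L.ncard = F + 1 := by exact_mod_cast hcard
  have hmul' : (genus S : ℚ) ≤ type S * L.ncard := by exact_mod_cast hmul
  have ht' : (type S : ℚ) + 1 ≤ embDim S := by exact_mod_cast ht
  have hL0 : (0 : ℚ) ≤ L.ncard := by positivity
  push_cast
  rw [← hcard']
  nlinarith [mul_le_mul_of_nonneg_right ht' hL0]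

theorem IsConeProj.wilf {S : AddSubmonoid ℕ} {u w : ℤ × ℤ} (h : IsConeProj S u w) (hS : S ≠ ⊤) :
    IsNumerical S ∧ type S < embDim S ∧ Wilf S := by
  obtain ⟨u', w', h', h₁, h₂⟩ := h.exists_narrow hS
  have ht := h'.type_lt_embDim h₁ h₂
  exact ⟨h.isNumerical, ht, h.isNumerical.wilf_of_type_lt_embDim hS ht⟩

/-! ### Quotients of `⟨a, b⟩` and proportionally modular semigroups -/

/-- Membership says that some multiple of b lies in [(a - c) n, a n]; the largest multiple to try is
a n - (a n mod b). -/
theorem isConeProj_propModular {a b c : ℕ} (hb : 0 < b) (hc : 0 < c) :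
    IsConeProj (propModular a b c) (b, (a : ℤ) - c) (b, a) := by
  have hb' : (0 : ℤ) < b := by exact_mod_cast hb
  have hc' : (0 : ℤ) < c := by exact_mod_cast hc
  refine ⟨hb', hb', by simp only [cross]; nlinarith, fun n => ?_⟩
  have hdiv : (b : ℤ) * ((a * n : ℕ) / b : ℤ) + ((a * n % b : ℕ) : ℤ) = a * n := by
    have := Int.mul_ediv_add_emod ((a * n : ℕ) : ℤ) b
    push_cast at this ⊢
    exact this
  have hmod := Nat.zero_le (a * n % b)
  have hlt : ((a * n % b : ℕ) : ℤ) < b := by exact_mod_cast Nat.mod_lt _ hb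
  change a * n % b ≤ c * n ↔ _
  set r := a * n % b
  set k := ((a * n : ℕ) / b : ℤ)
  simp only [cone, cross, Set.mem_ofPred_eq]
  constructor
  · intro hn
    have : (r : ℤ) ≤ c * n := by exact_mod_cast hn
    exact ⟨k, by nlinarith, by nlinarith⟩
  · rintro ⟨j, hj₁, hj₂⟩
    have hjk : j ≤ k := by
      by_contra! hc
      nlinarith [Int.add_one_le_iff.2 hc]
    have : (r : ℤ) ≤ c * n := by nlinarith
    exact_mod_cast this

theorem mem_gen_iff {a b n : ℕ} : n ∈ gen a b ↔ ∃ p q : ℕ, a * p + b * q = n := by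
  simp only [gen, AddSubmonoid.mem_closure_pair, smul_eq_mul, mul_comm a, mul_comm b]

/-- Take s a + t b = 1 and u = (a, -d t), w = (b, d s). The coefficients in d n = a p + b q are then
p = cross v w and q = cross u v for v = (n, q s - p t), so their signs cut out the cone. -/
theorem exists_isConeProj_quot {a b d : ℕ} (ha : 0 < a) (hb : 0 < b) (hd : 0 < d)
    (hab : Nat.Coprime a b) : ∃ u w, IsConeProj (quot (gen a b) d) u w := by
  obtain ⟨s, t, hst⟩ := Nat.isCoprime_iff_coprime.2 hab
  have ha' : (0 : ℤ) < a := by exact_mod_cast ha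
  have hb' : (0 : ℤ) < b := by exact_mod_cast hb
  have hN : cross (a, -(d * t)) (b, d * s) = d := by
    simp only [cross]; linear_combination (d : ℤ) * hst
  refine ⟨(a, -(d * t)), (b, d * s), ha', hb', by rw [hN]; exact_mod_cast hd, fun n => ?_⟩
  change d * n ∈ gen a b ↔ _
  rw [mem_gen_iff]
  constructor
  · rintro ⟨p, q, hpq⟩
    have hpq' : (a : ℤ) * p + b * q = d * n := by exact_mod_cast hpq
    refine ⟨q * s - p * t, ?_, ?_⟩
    · have : cross (a, -(d * t)) (n, q * s - p * t) = q := by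
        simp only [cross]; linear_combination (q : ℤ) * hst - t * hpq'
      rw [this]; positivity
    · have : cross ((n : ℤ), q * s - p * t) (b, d * s) = p := by
        simp only [cross]; linear_combination (p : ℤ) * hst - s * hpq'
      rw [this]; positivity
  · rintro ⟨k, hk₁, hk₂⟩
    have e := cross_mul_fst (a, -(d * t)) (n, k) (b, d * s)
    rw [hN] at e
    obtain ⟨q, hq⟩ := Int.eq_ofNat_of_zero_le hk₁
    obtain ⟨p, hp⟩ := Int.eq_ofNat_of_zero_le hk₂
    rw [hp, hq] at e
    refine ⟨p, q, ?_⟩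
    simp only at e
    zify
    linarith

end NumSgp

theorem theorem11 :
    (∀ a b d : ℕ, 0 < a → 0 < b → 0 < d →
      Nat.Coprime a b → Nat.Coprime a d → Nat.Coprime b d →
      d ∉ NumSgp.gen a b →
        NumSgp.IsNumerical (NumSgp.quot (NumSgp.gen a b) d) ∧
        NumSgp.type (NumSgp.quot (NumSgp.gen a b) d)
          < NumSgp.embDim (NumSgp.quot (NumSgp.gen a b) d) ∧
        NumSgp.Wilf (NumSgp.quot (NumSgp.gen a b) d)) ∧
    (∀ S : AddSubmonoid ℕ, NumSgp.IsProportionallyModular S → S ≠ ⊤ →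
        NumSgp.IsNumerical S ∧
        NumSgp.type S < NumSgp.embDim S ∧
        NumSgp.Wilf S) := by
  refine ⟨fun a b d ha hb hd hab _ _ hmem => ?_, ?_⟩
  · obtain ⟨u, w, h⟩ := NumSgp.exists_isConeProj_quot ha hb hd hab
    refine h.wilf fun htop => hmem ?_
    have h1 : 1 ∈ NumSgp.quot (NumSgp.gen a b) d := htop ▸ AddSubmonoid.mem_top 1
    have h2 : d * 1 ∈ NumSgp.gen a b := h1
    rwa [mul_one] at h2
  · rintro S ⟨a, b, c, -, hb, hc, rfl⟩ hS
    exact (NumSgp.isConeProj_propModular hb hc).wilf hS
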